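/- **Setting.** Values are rationals (in particular integers) and lists of values. For a finite set $S$ of variables, $\mathsf{Mem}_S$ is the set of memories $\sigma\colon S\to\mathsf{Val}$; for $T\subseteq S$, $\pi_T\colon\mathsf{Mem}_S\to\mathsf{Mem}_T$ is the restriction. For disjoint $S,T$, $\sigma\uplus\tau\in\mathsf{Mem}_{S\cup T}$ is the union of memories and $\mathcal I * \mathcal J=\{\sigma\uplus\tau\mid\sigma\in \mathcal I,\tau\in \mathcal J\}$. The empty memory is $\mathsf{emp}\in\mathsf{Mem}_\emptyset$. For a set $X$, order the discrete distributions $\mathcal D(X\cup\{\bot\})$ by $\mu\sqsubseteq\nu$ iff $\mu(x)\le\nu(x)$ for all $x\in X$ and $\mu(\bot)\ge\nu(\bot)$. The convex powerset $\mathcal C(X)$ consists of the nonempty, up-closed, convex sets $S\subseteq\mathcal D(X\cup\{\bot\})$ that are closed in the product of the Euclidean topologies on the coordinates $x \in X$. It carries the Smyth order $S\sqsubseteq_{\mathcal C}T$ iff $\forall\nu\in T\,\exists\mu\in S.\ \mu\sqsubseteq\nu$ (equivalently $S\supseteq T$), with least element $\bot_{\mathcal C}=\mathcal D(X\cup\{\bot\})$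 and directed suprema given by intersection. Let $\eta(x)=\{\delta_x\}$ and $f^\dagger(S)=\{\sum_{x\in\mathrm{supp}\,\mu}\mu(x)\nu_x\mid\mu\in S,\ \nu_x\in f_\bot(x)\}$, where $f_\bot(x)=f(x)$ for $x\in X$ and $f_\bot(\bot)=\bot_{\mathcal C}$. For a nonempty finite index set $K$, let $\&_{i\in K}S_i=\{\sum_i p_i\nu_i\mid p\in\mathcal D(K),\ \nu_i\in S_i\}$. Actions are assignments $x:=e$ and samplings from Bernoulli, geometric or uniform distributions with a parameter $e$. Their semantics $[\![a]\!]\colon\mathsf{Mem}_W\to\mathcal C(\mathsf{Mem}_W)$ is the usual one, with value $\bot_{\mathcal C}$ when undefined (for instance, when a variable is not in $W$). For a finite $\mathcal I\subseteq\mathsf{Mem}_U$ with $U\subseteq W$, the invariant-sensitive semantics is $$[\![a]\!]^{\mathcal I}=(\mathsf{check}^{\mathcal I})^\dagger\circ[\![a]\!]^\dagger\circ(\mathsf{replace}^{\mathcal I})^\dagger\circ\mathsf{check}^{\mathcal I},$$ where $\mathsf{check}^{\mathcal I}(\sigma)$ is $\eta(\sigma)$ if $\pi_U(\sigma)\in \mathcal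 I$ and $\bot_{\mathcal C}$ otherwise, and $\mathsf{replace}^{\mathcal I}(\sigma)=\&_{\tau\in \mathcal I}\,\eta(\pi_{W\setminus U}(\sigma)\uplus\tau)$ (and $\bot_{\mathcal C}$ if $\mathcal I=\emptyset$). A *labelled partial order with formulae* $\alpha=\langle N,<,\lambda,\varphi\rangle$ consists of a strict poset $\langle N,<\rangle$ of nodes from a countable universe, with a single minimal element, in which every node has a finite distance from this root (the length of a longest chain that ends in the node) and finitely many nodes have any given distance; labels $\lambda(x)$ that are actions, tests, a no-op $\bullet$ or $\bot$, where nodes labelled $\bot$ have no successors; and satisfiable Boolean formulae $\varphi(x)$ over the nodes $y<x$, with $\varphi(y)\Rightarrow\varphi(x)$ for $x<y$. A *pomset with formulae* is an isomorphism class $A=[\alpha]$ of these. We write $A'\ll A$ if $A'$ is finite and $A$ is obtained from it by replacing nodes labelled $\bot$ by larger structures: for suitable representatives $\alpha'$ and $\alpha$, $N_{\alpha'}\subseteq N_\alpha$, order and formulae agree on $N_{\alpha'}$, each $x\in N_{\alpha'}$ has $\lambda_{\alpha'}(x)\in\{\bot,\lambda_\alpha(x)\}$, and each node in $N_\alpha\setminus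 N_{\alpha'}$ is above some $x\in N_{\alpha'}$ with $\lambda_{\alpha'}(x)=\bot$. For finite $\alpha$, a path condition $\psi$ and a set $S$ of processed nodes, let $\mathsf{next}(\alpha,\psi,S)$ be the set of $x\in N\setminus S$ such that all $y<x$ are in $S$ and $\psi\Rightarrow\varphi(x)$. Let $\mathsf{lin}^{\mathcal I}(\alpha,\psi,S)(\sigma)$ be $\eta(\sigma)$ if this set is empty, and otherwise $\&_{x\in\mathsf{next}(\alpha,\psi,S)}L_x$, where, with $S'=S\cup\{x\}$: $L_x=\mathsf{lin}^{\mathcal I}(\alpha,\psi,S')^\dagger([\![a]\!]^{\mathcal I}(\sigma))$ if $\lambda(x)$ is an action $a$; $L_x=\mathsf{lin}^{\mathcal I}(\alpha,\psi\wedge x,S')(\sigma)$, respectively $\mathsf{lin}^{\mathcal I}(\alpha,\psi\wedge\neg x,S')(\sigma)$, if $\lambda(x)$ is a test that is true, respectively false, in $\sigma$ (and $\bot_{\mathcal C}$ if it is undefined in $\sigma$); $L_x=\mathsf{lin}^{\mathcal I}(\alpha,\psi,S')(\sigma)$ if $\lambda(x)=\bullet$; and $L_x=\bot_{\mathcal C}$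 if $\lambda(x)=\bot$. The *linearization* of a pomset is $\mathsf{lin}^{\mathcal I}(A)(\sigma)=\sup_{[\alpha']\ll A}\mathsf{lin}^{\mathcal I}(\alpha',\mathsf{true},\emptyset)(\sigma)\in\mathcal C(\mathsf{Mem}_W)$; the true semantics is $\mathsf{lin}^{\{\mathsf{emp}\}}$. **Lemma (Invariant Monotonicity).** Let $U,V,W$ be finite sets of variables with $U\cap V=\emptyset$ and $U\cup V\subseteq W$, and let $\mathcal I\subseteq\mathsf{Mem}_U$ and $\mathcal J\subseteq\mathsf{Mem}_V$ be finite. Then for every pomset with formulae $A$ and every $\sigma\in\mathsf{Mem}_W$, $$\mathsf{lin}^{\mathcal I*\mathcal J}(A)(\sigma)\ \sqsubseteq_{\mathcal C}\ \mathsf{lin}^{\mathcal I}(A)(\sigma),$$ that is, $\mathsf{lin}^{\mathcal I}(A)(\sigma)\subseteq\mathsf{lin}^{\mathcal I*\mathcal J}(A)(\sigma)$. In particular, adding an invariant over-approximates the true semantics: $\mathsf{lin}^{\{\mathsf{emp}\}}(A)(\sigma)\subseteq\mathsf{lin}^{\mathcal I}(A)(\sigma)$. -/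

import Mathlib

open scoped ENNReal

noncomputable section

namespace PCOL

/-! ### Discrete distributions with a divergence element -/

/-- Distributions over `X ∪ {⊥}`; the extra point `none` is `⊥`. -/
abbrev Dst (X : Type) := PMF (Option X)

/-- The order on distributions: `μ ⊑ ν` iff `μ x ≤ ν x` for `x ∈ X` and `ν ⊥ ≤ μ ⊥`. -/
def DLe {X : Type} (μ ν : Dst X) : Prop :=
  (∀ x : X, μ (some x) ≤ ν (some x)) ∧ ν none ≤ μ none

/-- The convex combination `p · μ + q · ν`, where `p + q = 1`. -/
def mix {A : Type} (p q : ℝ≥0∞) (h : p + q = 1) (μ ν : PMF A) : PMF A :=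
  ⟨fun a => p * μ a + q * ν a, by
    have : ∑' a, (p * μ a + q * ν a) = 1 := by
      rw [ENNReal.tsum_add, ENNReal.tsum_mul_left, ENNReal.tsum_mul_left, μ.tsum_coe, ν.tsum_coe,
        mul_one, mul_one, h]
    exact (Summable.hasSum_iff ENNReal.summable).2 this⟩

theorem mix_apply {A : Type} (p q : ℝ≥0∞) (h : p + q = 1) (μ ν : PMF A) (a : A) :
    mix p q h μ ν a = p * μ a + q * ν a := rfl

/-- The coordinates of a distribution in `ℝ^X`; the mass of `⊥` is the missing mass. -/
def sub {X : Type} (μ : Dst X) : X → ℝ := fun x => (μ (some x)).toReal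

theorem tsum_opt {X : Type} (g : Option X → ℝ≥0∞) :
    ∑' o, g o = g none + ∑' x, g (some x) := by
  rw [← (Equiv.optionEquivSumPUnit.{0} X).symm.tsum_eq,
    Summable.tsum_sum ENNReal.summable ENNReal.summable, add_comm]
  simp

theorem bot_add {X : Type} (μ : Dst X) : μ none + ∑' x, μ (some x) = 1 := by
  rw [← tsum_opt, μ.tsum_coe]

theorem ext_some {X : Type} {μ ν : Dst X} (h : ∀ x, μ (some x) = ν (some x)) : μ = ν := by
  have hs : ∑' x, μ (some x) = ∑' x, ν (some x) := tsum_congr h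
  have h1 := bot_add μ
  have h2 := bot_add ν
  rw [hs] at h1
  have hfin : ∑' x, ν (some x) ≠ ∞ := fun e => by rw [e] at h2; simp at h2
  ext o
  cases o with
  | none => exact (ENNReal.add_left_inj hfin).1 (h1.trans h2.symm)
  | some x => exact h x

theorem dLe_of_some {X : Type} {μ ν : Dst X} (h : ∀ x, μ (some x) ≤ ν (some x)) : DLe μ ν := by
  refine ⟨h, ?_⟩
  have hs : ∑' x, μ (some x) ≤ ∑' x, ν (some x) := ENNReal.tsum_le_tsum h
  have h1 := bot_add μ
  have h2 := bot_add ν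
  have hfin : ∑' x, ν (some x) ≠ ∞ := fun e => by rw [e] at h2; simp at h2
  refine (ENNReal.add_le_add_iff_right hfin).1 ?_
  calc ν none + ∑' x, ν (some x) = μ none + ∑' x, μ (some x) := h2.trans h1.symm
    _ ≤ _ := by gcongr

theorem pmf_eq_of_le {A : Type} {μ ν : PMF A} (h : ∀ a, μ a ≤ ν a) : μ = ν := by
  ext a
  by_contra hne
  have := ENNReal.tsum_lt_tsum (by rw [μ.tsum_coe]; simp) h (lt_of_le_of_ne (h a) hne)
  rw [μ.tsum_coe, ν.tsum_coe] at this
  exact lt_irrefl _ this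

theorem dLe_refl {X : Type} (μ : Dst X) : DLe μ μ := ⟨fun _ => le_rfl, le_rfl⟩

/-- The distribution with given coordinates on `X`, all remaining mass on `⊥`. -/
def ofSub {X : Type} (g : X → ℝ≥0∞) (h : ∑' x, g x ≤ 1) : Dst X :=
  ⟨fun o => o.elim (1 - ∑' x, g x) g, by
    have : ∑' o : Option X, o.elim (1 - ∑' x, g x) g = 1 := by
      rw [tsum_opt]; exact tsub_add_cancel_of_le h
    exact (Summable.hasSum_iff ENNReal.summable).2 this⟩

theorem ofSub_some {X : Type} (g : X → ℝ≥0∞) (h : ∑' x, g x ≤ 1) (x : X) :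
    ofSub g h (some x) = g x := rfl

theorem sub_injective {X : Type} : Function.Injective (sub (X := X)) := fun μ ν h =>
  ext_some fun x => (ENNReal.toReal_eq_toReal_iff' (μ.apply_ne_top _) (ν.apply_ne_top _)).1
    (congrFun h x)

/-- The coordinate vectors of all distributions. -/
def subSet (X : Type) : Set (X → ℝ) :=
  {g | (∀ x, 0 ≤ g x) ∧ ∀ s : Finset X, ∑ x ∈ s, g x ≤ 1}

theorem range_sub (X : Type) : Set.range (sub (X := X)) = subSet X := by
  ext g
  constructor
  · rintro ⟨μ, rfl⟩
    refine ⟨fun x => ENNReal.toReal_nonneg, fun s => ?_⟩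
    unfold sub
    rw [← ENNReal.toReal_sum fun x _ => μ.apply_ne_top _]
    refine ENNReal.toReal_le_of_le_ofReal zero_le_one ?_
    rw [ENNReal.ofReal_one]
    refine (ENNReal.sum_le_tsum s).trans ?_
    rw [← bot_add μ]
    exact le_add_self
  · rintro ⟨h0, h1⟩
    refine ⟨ofSub (fun x => ENNReal.ofReal (g x)) ?_, ?_⟩
    · rw [ENNReal.tsum_eq_iSup_sum]
      refine iSup_le fun s => ?_
      rw [← ENNReal.ofReal_sum_of_nonneg fun x _ => h0 x]
      exact (ENNReal.ofReal_le_ofReal (h1 s)).trans_eq ENNReal.ofReal_one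
    · funext x
      exact ENNReal.toReal_ofReal (h0 x)

theorem isCompact_subSet (X : Type) : IsCompact (subSet X) := by
  have hc : IsCompact (Set.univ.pi fun _ : X => Set.Icc (0 : ℝ) 1) :=
    isCompact_univ_pi fun _ => isCompact_Icc
  refine hc.of_isClosed_subset ?_ ?_
  · have : subSet X = (⋂ x, {g | 0 ≤ g x}) ∩ ⋂ s : Finset X, {g | ∑ x ∈ s, g x ≤ 1} := by
      ext g; simp [subSet]
    rw [this]
    refine (isClosed_iInter fun x => ?_).inter (isClosed_iInter fun s => ?_)
    · exact isClosed_le continuous_const (continuous_apply x)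
    · exact isClosed_le (continuous_finsetSum _ fun x _ => continuous_apply x) continuous_const
  · intro g hg x _
    exact ⟨hg.1 x, by simpa using hg.2 {x}⟩

/-! ### The convex powerset -/

/-- The convex powerset `𝒞(X)`: nonempty, up-closed, convex and Cauchy closed sets of
distributions over `X ∪ {⊥}`. Closedness is with respect to the product of the Euclidean
topologies on the coordinates in `X` (the mass of `⊥` is determined by the other coordinates). -/
@[ext]
structure ConvPow (X : Type) where
  carrier : Set (Dst X)
  nonempty : carrier.Nonempty
  up_closed : ∀ μ ∈ carrier, ∀ ν, DLe μ ν → ν ∈ carrier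
  convex : ∀ μ ∈ carrier, ∀ ν ∈ carrier, ∀ (p q : ℝ≥0∞) (h : p + q = 1),
    mix p q h μ ν ∈ carrier
  closed : IsClosed (sub '' carrier)

namespace ConvPow

variable {X Y : Type}

/-- The Smyth order: `S ⊑ T` iff every `ν ∈ T` is above some `μ ∈ S`. -/
instance : LE (ConvPow X) where
  le S T := ∀ ν ∈ T.carrier, ∃ μ ∈ S.carrier, DLe μ ν

theorem le_iff {S T : ConvPow X} : S ≤ T ↔ T.carrier ⊆ S.carrier :=
  ⟨fun h ν hν => let ⟨μ, hμ, hl⟩ := h ν hν; S.up_closed μ hμ ν hl,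
    fun h ν hν => ⟨ν, h hν, dLe_refl ν⟩⟩

instance : PartialOrder (ConvPow X) where
  le_refl S := le_iff.2 subset_rfl
  le_trans S T R h1 h2 := le_iff.2 ((le_iff.1 h2).trans (le_iff.1 h1))
  le_antisymm S T h1 h2 := ConvPow.ext (Set.Subset.antisymm (le_iff.1 h2) (le_iff.1 h1))

/-- The least element: all distributions (undefined behaviour and nontermination). -/
instance : OrderBot (ConvPow X) where
  bot :=
    { carrier := Set.univ
      nonempty := ⟨PMF.pure none, trivial⟩
      up_closed := fun _ _ _ _ => trivial
      convex := fun _ _ _ _ _ _ _ => trivial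
      closed := by
        rw [Set.image_univ, range_sub]
        exact (isCompact_subSet X).isClosed }
  bot_le S := le_iff.2 (Set.subset_univ _)

theorem mem_bot (μ : Dst X) : μ ∈ (⊥ : ConvPow X).carrier := trivial

theorem isCompact (S : ConvPow X) : IsCompact (sub '' S.carrier) :=
  (isCompact_subSet X).of_isClosed_subset S.closed
    (by rw [← range_sub]; exact Set.image_subset_range _ _)

/-- The set whose only element is a distribution `μ` over `X` (with no mass on `⊥`). -/
def single (μ : PMF X) : ConvPow X where
  carrier := {μ.map some}
  nonempty := ⟨_, rfl⟩
  up_closed := by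
    rintro _ rfl ν h
    have hz : (μ.map some) none = 0 := by
      rw [PMF.apply_eq_zero_iff]; simp
    refine (pmf_eq_of_le fun o => ?_).symm
    cases o with
    | none => rw [hz]; exact zero_le
    | some x => exact h.1 x
  convex := by
    rintro _ rfl _ rfl p q h
    ext a
    rw [mix_apply, ← add_mul, h, one_mul]
  closed := by
    rw [Set.image_singleton]; exact isClosed_singleton

/-- The unit `η(x) = {δ_x}`. -/
def eta (x : X) : ConvPow X := single (PMF.pure x)

/-- `f_⊥` extends `f` by `f_⊥(⊥) = ⊥`. -/
def fbot (f : X → ConvPow Y) : Option X → ConvPow Y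
  | none => ⊥
  | some x => f x

/-- The sets underlying the Kleisli extension. -/
def kleisliSet (f : X → ConvPow Y) (S : ConvPow X) : Set (Dst Y) :=
  {ρ | ∃ μ ∈ S.carrier, ∃ ν : Option X → Dst Y,
    (∀ x ∈ μ.support, ν x ∈ (fbot f x).carrier) ∧ ρ = μ.bind ν}


theorem kleisli_refine {β ρ : Dst Y} (h : DLe β ρ) :
    ∃ g : Option Y → Dst Y, (∀ y, g (some y) = PMF.pure (some y)) ∧ ρ = β.bind g := by
  have key : ∃ κ : Dst Y, ∀ y, β (some y) + β none * κ (some y) = ρ (some y) := by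
    by_cases hb : β none = 0
    · refine ⟨PMF.pure none, fun y => ?_⟩
      have : β = ρ := pmf_eq_of_le fun o => by
        cases o with
        | none => rw [hb]; exact zero_le
        | some y => exact h.1 y
      rw [hb, this, zero_mul, add_zero]
    · have hbt : β none ≠ ∞ := β.apply_ne_top _
      have hs : ∑' y, (ρ (some y) - β (some y)) ≤ β none := by
        have h1 : ∑' y, (ρ (some y) - β (some y)) + ∑' y, β (some y) = ∑' y, ρ (some y) := by
          rw [← ENNReal.tsum_add]
          exact tsum_congr fun y => tsub_add_cancel_of_le (h.1 y)
        have h2 := bot_add β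
        have h3 := bot_add ρ
        have hfin : ∑' y, β (some y) ≠ ∞ := fun e => by rw [e] at h2; simp at h2
        refine (ENNReal.add_le_add_iff_right hfin).1 ?_
        rw [h1, h2, ← h3]
        exact le_add_self
      refine ⟨ofSub (fun y => (ρ (some y) - β (some y)) * (β none)⁻¹) ?_, fun y => ?_⟩
      · rw [ENNReal.tsum_mul_right]
        calc _ ≤ β none * (β none)⁻¹ := by gcongr
          _ = 1 := ENNReal.mul_inv_cancel hb hbt
      · rw [ofSub_some, mul_comm (β none), mul_assoc, ENNReal.inv_mul_cancel hb hbt, mul_one]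
        exact add_tsub_cancel_of_le (h.1 y)
  obtain ⟨κ, hκ⟩ := key
  refine ⟨fun o => o.elim κ fun y => PMF.pure (some y), fun y => rfl, ext_some fun y => ?_⟩
  rw [← hκ y, PMF.bind_apply, tsum_opt, add_comm]
  congr 1
  rw [tsum_eq_single y]
  · simp
  · intro z hz
    simp [PMF.pure_apply, Ne.symm hz]

theorem dLe_bind (β : Dst Y) {g : Option Y → Dst Y} (hg : ∀ y, g (some y) = PMF.pure (some y)) :
    DLe β (β.bind g) := dLe_of_some fun y => by
  rw [PMF.bind_apply]
  refine le_trans ?_ (ENNReal.le_tsum (some y))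
  simp [hg]

theorem mem_kleisliSet {f : X → ConvPow Y} {S : ConvPow X} {ρ : Dst Y} :
    ρ ∈ kleisliSet f S ↔ ∃ μ ∈ S.carrier, ∃ n : X → Dst Y, (∀ x, n x ∈ (f x).carrier) ∧
      ∀ y, ∑' x, μ (some x) * n x (some y) ≤ ρ (some y) := by
  classical
  constructor
  · rintro ⟨μ, hμ, ν, hν, rfl⟩
    refine ⟨μ, hμ, fun x => if some x ∈ μ.support then ν (some x) else (f x).nonempty.some,
      fun x => ?_, fun y => ?_⟩
    · dsimp only
      split_ifs with hx
      · exact hν _ hx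
      · exact (f x).nonempty.some_mem
    · rw [PMF.bind_apply, tsum_opt]
      refine le_trans (ENNReal.tsum_le_tsum fun x => ?_) le_add_self
      dsimp only
      by_cases hx : some x ∈ μ.support
      · rw [if_pos hx]
      · rw [(PMF.apply_eq_zero_iff _ _).2 hx, zero_mul]; exact zero_le
  · rintro ⟨μ, hμ, n, hn, hle⟩
    have hd : DLe (μ.bind fun o => o.elim (PMF.pure none) n) ρ := dLe_of_some fun y => by
      refine le_trans (le_of_eq ?_) (hle y)
      rw [PMF.bind_apply, tsum_opt]
      simp
    obtain ⟨g, hg, rfl⟩ := kleisli_refine hd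
    refine ⟨μ, hμ, fun o => (o.elim (PMF.pure none) n).bind g, fun o _ => ?_, PMF.bind_bind _ _ _⟩
    cases o with
    | none => exact mem_bot _
    | some x => exact (f x).up_closed _ (hn x) _ (dLe_bind _ hg)

theorem kleisliSet_closed (f : X → ConvPow Y) (S : ConvPow X) :
    IsClosed (sub '' kleisliSet f S) := by
  let K : Set (((X → ℝ) × (X → Y → ℝ)) × (Y → ℝ)) :=
    ((sub '' S.carrier) ×ˢ (Set.univ.pi fun x => sub '' (f x).carrier)) ×ˢ subSet Y
  have hK : IsCompact K :=
    ((S.isCompact).prod (isCompact_univ_pi fun x => (f x).isCompact)).prod (isCompact_subSet Y)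
  let R : Set (((X → ℝ) × (X → Y → ℝ)) × (Y → ℝ)) :=
    ⋂ (y : Y), ⋂ (s : Finset X), {t | ∑ x ∈ s, t.1.1 x * t.1.2 x y ≤ t.2 y}
  have hR : IsClosed R := isClosed_iInter fun y => isClosed_iInter fun s =>
    isClosed_le (by fun_prop) (by fun_prop)
  have heq : sub '' kleisliSet f S = Prod.snd '' (K ∩ R) := by
    have conv : ∀ (μ : Dst X) (n : X → Dst Y) (ρ : Dst Y) (y : Y),
        (∑' x, μ (some x) * n x (some y) ≤ ρ (some y)) ↔
          ∀ s : Finset X, ∑ x ∈ s, sub μ x * sub (n x) y ≤ sub ρ y := by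
      intro μ n ρ y
      rw [ENNReal.tsum_eq_iSup_sum, iSup_le_iff]
      refine forall_congr' fun s => ?_
      have hne : ∀ x ∈ s, μ (some x) * n x (some y) ≠ ∞ := fun x _ =>
        ENNReal.mul_ne_top (μ.apply_ne_top _) ((n x).apply_ne_top _)
      unfold sub
      rw [← ENNReal.toReal_le_toReal (ENNReal.sum_ne_top.2 hne) (ρ.apply_ne_top _),
        ENNReal.toReal_sum hne]
      simp only [ENNReal.toReal_mul]
    ext g
    constructor
    · rintro ⟨ρ, hρ, rfl⟩
      obtain ⟨μ, hμ, n, hn, hle⟩ := mem_kleisliSet.1 hρ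
      refine ⟨((sub μ, fun x => sub (n x)), sub ρ), ⟨⟨⟨⟨μ, hμ, rfl⟩, fun x _ => ⟨n x, hn x, rfl⟩⟩,
        ?_⟩, ?_⟩, rfl⟩
      · rw [← range_sub]; exact ⟨ρ, rfl⟩
      · simp only [R, Set.mem_iInter, Set.mem_ofPred_eq]
        exact fun y => (conv μ n ρ y).1 (hle y)
    · rintro ⟨⟨⟨m, n'⟩, g'⟩, ⟨⟨⟨⟨μ, hμ, rfl⟩, hn⟩, hg⟩, hr⟩, rfl⟩
      rw [← range_sub] at hg
      obtain ⟨ρ, rfl⟩ := hg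
      choose n hn hn' using fun x => hn x trivial
      refine ⟨ρ, mem_kleisliSet.2 ⟨μ, hμ, n, hn, fun y => (conv μ n ρ y).2 fun s => ?_⟩, rfl⟩
      simp only [R, Set.mem_iInter, Set.mem_ofPred_eq] at hr
      refine le_trans (le_of_eq ?_) (hr y s)
      exact Finset.sum_congr rfl fun x _ => by rw [hn' x]
  rw [heq]
  exact ((hK.inter_right hR).image continuous_snd).isClosed

theorem kleisliSet_convex (f : X → ConvPow Y) (S : ConvPow X) {ρ₁ ρ₂ : Dst Y}
    (h₁ : ρ₁ ∈ kleisliSet f S) (h₂ : ρ₂ ∈ kleisliSet f S) (p q : ℝ≥0∞) (h : p + q = 1) :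
    mix p q h ρ₁ ρ₂ ∈ kleisliSet f S := by
  obtain ⟨μ₁, hμ₁, n₁, hn₁, hl₁⟩ := mem_kleisliSet.1 h₁
  obtain ⟨μ₂, hμ₂, n₂, hn₂, hl₂⟩ := mem_kleisliSet.1 h₂
  have hp : p ≠ ∞ := fun e => by rw [e] at h; simp at h
  have hq : q ≠ ∞ := fun e => by rw [e] at h; simp at h
  have key : ∀ x, ∃ n ∈ (f x).carrier, ∀ y, (p * μ₁ (some x) + q * μ₂ (some x)) * n (some y) =
      p * μ₁ (some x) * n₁ x (some y) + q * μ₂ (some x) * n₂ x (some y) := by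
    intro x
    set a := p * μ₁ (some x) with ha
    set b := q * μ₂ (some x) with hb
    have hat : a ≠ ∞ := ENNReal.mul_ne_top hp (μ₁.apply_ne_top _)
    have hbt : b ≠ ∞ := ENNReal.mul_ne_top hq (μ₂.apply_ne_top _)
    by_cases hz : a + b = 0
    · refine ⟨n₁ x, hn₁ x, fun y => ?_⟩
      obtain ⟨h1, h2⟩ := add_eq_zero.1 hz
      rw [h1, h2]; simp
    · have hc := ENNReal.mul_inv_cancel hz (ENNReal.add_ne_top.2 ⟨hat, hbt⟩)
      refine ⟨mix (a * (a + b)⁻¹) (b * (a + b)⁻¹) (by rw [← add_mul, hc]) (n₁ x) (n₂ x),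
        (f x).convex _ (hn₁ x) _ (hn₂ x) _ _ _, fun y => ?_⟩
      rw [mix_apply]
      calc _ = ((a + b) * (a + b)⁻¹) * (a * n₁ x (some y) + b * n₂ x (some y)) := by ring
        _ = _ := by rw [hc, one_mul]
  choose n hn hn' using key
  refine mem_kleisliSet.2 ⟨mix p q h μ₁ μ₂, S.convex _ hμ₁ _ hμ₂ _ _ _, n, hn, fun y => ?_⟩
  simp only [mix_apply, hn', ENNReal.tsum_add, mul_assoc, ENNReal.tsum_mul_left]
  gcongr
  · exact hl₁ y
  · exact hl₂ y

/-- The Kleisli extension `f†(S) = {∑ μ(x) · ν_x | μ ∈ S, ν_x ∈ f_⊥(x) for x ∈ supp μ}`. -/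
def kleisli (f : X → ConvPow Y) (S : ConvPow X) : ConvPow Y where
  carrier := kleisliSet f S
  nonempty := by
    obtain ⟨μ, hμ⟩ := S.nonempty
    exact ⟨_, μ, hμ, fun x => (fbot f x).nonempty.some,
      fun x _ => (fbot f x).nonempty.some_mem, rfl⟩
  up_closed := by
    intro ρ hρ ρ' hle
    obtain ⟨μ, hμ, n, hn, hl⟩ := mem_kleisliSet.1 hρ
    exact mem_kleisliSet.2 ⟨μ, hμ, n, hn, fun y => (hl y).trans (hle.1 y)⟩
  convex := fun _ h₁ _ h₂ p q h => kleisliSet_convex f S h₁ h₂ p q h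
  closed := kleisliSet_closed f S

theorem kleisli_mono {f g : X → ConvPow Y} {S T : ConvPow X} (hfg : ∀ x, f x ≤ g x) (h : S ≤ T) :
    kleisli f S ≤ kleisli g T := by
  refine le_iff.2 ?_
  rintro ρ ⟨μ, hμ, ν, hν, rfl⟩
  refine ⟨μ, le_iff.1 h hμ, ν, fun x hx => ?_, rfl⟩
  cases x with
  | none => exact mem_bot _
  | some x => exact le_iff.1 (hfg x) (hν _ hx)

/-- All distributions over a nonempty finite index set, with no mass on `⊥`. -/
def simplex (ι : Type) [Finite ι] [Nonempty ι] : ConvPow ι where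
  carrier := {μ | μ none = 0}
  nonempty := ⟨PMF.pure (some (Classical.arbitrary ι)), by simp [PMF.pure_apply]⟩
  up_closed := fun μ hμ ν h => le_antisymm (h.2.trans_eq hμ) zero_le
  convex := by
    intro μ hμ ν hν p q h
    rw [Set.mem_ofPred_eq] at *
    rw [mix_apply, hμ, hν]; simp
  closed := by
    have := Fintype.ofFinite ι
    have heq : sub '' {μ : Dst ι | μ none = 0} = subSet ι ∩ {g | ∑ i, g i = 1} := by
      have conv : ∀ μ : Dst ι, μ none = 0 ↔ ∑ i, sub μ i = 1 := by
        intro μ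
        have h1 := bot_add μ
        rw [tsum_fintype] at h1
        have hne : ∀ i ∈ Finset.univ, μ (some i) ≠ ∞ := fun i _ => μ.apply_ne_top _
        have h2 : ∑ i, sub μ i = (∑ i, μ (some i)).toReal := (ENNReal.toReal_sum hne).symm
        have hfin := ENNReal.sum_ne_top.2 hne
        rw [h2, ENNReal.toReal_eq_one_iff]
        constructor
        · intro h; rwa [h, zero_add] at h1
        · intro h
          rw [h] at h1
          exact (ENNReal.add_left_inj ENNReal.one_ne_top).1 (h1.trans (zero_add 1).symm)
      ext g
      constructor
      · rintro ⟨μ, hμ, rfl⟩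
        refine ⟨?_, (conv μ).1 hμ⟩
        rw [← range_sub]; exact ⟨μ, rfl⟩
      · rintro ⟨hg, hs⟩
        rw [← range_sub] at hg
        obtain ⟨μ, rfl⟩ := hg
        exact ⟨μ, (conv μ).2 hs, rfl⟩
    rw [heq]
    exact (isCompact_subSet ι).isClosed.inter
      (isClosed_eq (continuous_finsetSum _ fun i _ => continuous_apply i) continuous_const)

/-- The finite convex union `S_{i₁} & ⋯ & S_{iₙ}`: all the sums `∑ p_i · ν_i` with `ν_i ∈ S_i`
and `p` a distribution over the nonempty finite index set. -/
def bigND {ι : Type} [Finite ι] [Nonempty ι] (F : ι → ConvPow X) : ConvPow X :=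
  kleisli F (simplex ι)

theorem bigND_le {ι κ : Type} [Finite ι] [Nonempty ι] [Finite κ] [Nonempty κ] (e : ι ≃ κ)
    {F : ι → ConvPow X} {G : κ → ConvPow X} (h : ∀ i, F i ≤ G (e i)) : bigND F ≤ bigND G := by
  refine le_iff.2 ?_
  rintro ρ ⟨μ, hμ, ν, hν, rfl⟩
  refine ⟨μ.map (Option.map e.symm), ?_, fun o => ν (o.map e), fun o ho => ?_, ?_⟩
  · change (μ.map (Option.map e.symm)) none = 0
    rw [PMF.apply_eq_zero_iff, PMF.support_map]
    rintro ⟨o, ho, ho'⟩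
    rw [Option.map_eq_none_iff] at ho'
    rw [ho'] at ho
    exact ho hμ
  · cases o with
    | none => exact mem_bot _
    | some i =>
      refine le_iff.1 (h i) (hν (some (e i)) ?_)
      rw [PMF.support_map] at ho
      obtain ⟨o, ho, ho'⟩ := ho
      obtain ⟨k, rfl, hk⟩ := Option.map_eq_some_iff.1 ho'
      rwa [← hk, e.apply_symm_apply]
  · rw [PMF.bind_map]
    congr 1
    funext o
    simp [Function.comp_def]

/-- The supremum of a directed set, which is its intersection (the supremum of `∅` is `⊥`). -/
def dSup (D : Set (ConvPow X)) (hD : DirectedOn (· ≤ ·) D) : ConvPow X where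
  carrier := ⋂ S ∈ D, S.carrier
  nonempty := by
    rcases D.eq_empty_or_nonempty with rfl | hne
    · exact ⟨PMF.pure none, by simp⟩
    · have : Nonempty ((fun S : ConvPow X => sub '' S.carrier) '' D) := (hne.image _).coe_sort
      obtain ⟨g, hg⟩ := IsCompact.nonempty_sInter_of_directed_nonempty_isCompact_isClosed
        (S := (fun S : ConvPow X => sub '' S.carrier) '' D)
        (by
          rintro _ ⟨S, hS, rfl⟩ _ ⟨T, hT, rfl⟩
          obtain ⟨R, hR, h1, h2⟩ := hD S hS T hT
          exact ⟨_, ⟨R, hR, rfl⟩, Set.image_mono (le_iff.1 h1), Set.image_mono (le_iff.1 h2)⟩)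
        (by rintro _ ⟨S, _, rfl⟩; exact S.nonempty.image _)
        (by rintro _ ⟨S, _, rfl⟩; exact S.isCompact)
        (by rintro _ ⟨S, _, rfl⟩; exact S.closed)
      have hg' : ∀ S ∈ D, g ∈ sub '' S.carrier := fun S hS => hg _ ⟨S, hS, rfl⟩
      obtain ⟨S, hS⟩ := hne
      obtain ⟨μ, _, rfl⟩ := hg' S hS
      refine ⟨μ, Set.mem_iInter₂.2 fun T hT => ?_⟩
      obtain ⟨ν, hν, he⟩ := hg' T hT
      exact sub_injective he ▸ hν
  up_closed := fun μ hμ ν h => Set.mem_iInter₂.2 fun S hS =>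
    S.up_closed μ (Set.mem_iInter₂.1 hμ S hS) ν h
  convex := fun μ hμ ν hν p q h => Set.mem_iInter₂.2 fun S hS =>
    S.convex μ (Set.mem_iInter₂.1 hμ S hS) ν (Set.mem_iInter₂.1 hν S hS) p q h
  closed := by
    rcases D.eq_empty_or_nonempty with rfl | hne
    · have := (⊥ : ConvPow X).closed
      rwa [Set.biInter_empty]
    · rw [Set.InjOn.image_biInter_eq hne sub_injective.injOn]
      exact isClosed_biInter fun S _ => S.closed

theorem isLUB_dSup (D : Set (ConvPow X)) (hD : DirectedOn (· ≤ ·) D) : IsLUB D (dSup D hD) :=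
  ⟨fun _ hS => le_iff.2 (Set.biInter_subset_of_mem hS),
    fun _ hT => le_iff.2 (Set.subset_iInter₂ fun _ hS => le_iff.1 (hT hS))⟩

end ConvPow

/-! ### Syntax and basic semantics of the language -/

/-- Program variables. -/
abbrev Var := String

/-- Values: rationals (the integers are those with denominator one) and lists. -/
inductive Val : Type
  | num (q : ℚ) : Val
  | list (l : List Val) : Val

mutual
/-- Expressions. The constructor `prim` stands for all further primitive operations, which may be
arbitrary partial functions on values. -/
inductive Exp : Type
  | var (x : Var) : Exp
  | val (v : Val) : Exp
  | test (b : Test) : Exp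
  | index (e i : Exp) : Exp
  | list {n : ℕ} (es : Fin n → Exp) : Exp
  | add (e₁ e₂ : Exp) : Exp
  | mul (e₁ e₂ : Exp) : Exp
  | prim {n : ℕ} (f : (Fin n → Val) → Option Val) (es : Fin n → Exp) : Exp

/-- Tests. The constructor `rel` stands for all further comparisons of values. -/
inductive Test : Type
  | tru : Test
  | fls : Test
  | and (b₁ b₂ : Test) : Test
  | or (b₁ b₂ : Test) : Test
  | not (b : Test) : Test
  | eq (e₁ e₂ : Exp) : Test
  | le (e₁ e₂ : Exp) : Test
  | lt (e₁ e₂ : Exp) : Test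
  | rel (r : Val → Val → Option Bool) (e₁ e₂ : Exp) : Test
end

/-- Families of distributions: Bernoulli, geometric, uniform. -/
inductive DistName : Type
  | bern : DistName
  | geo : DistName
  | unif : DistName

/-- Actions: assignment `x := e` and sampling `x :≈ d(e)`. -/
inductive Act : Type
  | assign (x : Var) (e : Exp) : Act
  | sample (x : Var) (d : DistName) (e : Exp) : Act

/-- Memories over a finite set `S` of variables. -/
abbrev Mem (S : Finset Var) : Type := S → Val

/-- A tuple of partial values is defined iff all its entries are. -/
def tuple {A : Type} {n : ℕ} (g : Fin n → Option A) : Option (Fin n → A) :=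
  open Classical in
  if h : ∀ i, (g i).isSome then some fun i => (g i).get (h i) else none

/-- List access, defined for natural indices below the length. -/
def Val.get : Val → Val → Option Val
  | .list l, .num q => if q.den = 1 ∧ 0 ≤ q then l[q.num.toNat]? else none
  | _, _ => none

/-- Lifting of an operation on numbers; undefined on lists. -/
def Val.num₂ {A : Type} (f : ℚ → ℚ → A) : Val → Val → Option A
  | .num p, .num q => some (f p q)
  | _, _ => none

mutual
/-- Evaluation of expressions: undefined (`none`) if a variable of the expression is not in the
domain of the memory, or if an operation is applied outside its domain. -/
def Exp.eval {S : Finset Var} (σ : Mem S) : Exp → Option Val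
  | .var x => if h : x ∈ S then some (σ ⟨x, h⟩) else none
  | .val v => some v
  | .test b => (b.eval σ).map fun t => .num (if t then 1 else 0)
  | .index e i => (e.eval σ).bind fun v => (i.eval σ).bind fun w => v.get w
  | .list es => (tuple fun i => (es i).eval σ).map fun vs => .list (List.ofFn vs)
  | .add e₁ e₂ => (e₁.eval σ).bind fun v => (e₂.eval σ).bind fun w =>
      (Val.num₂ (· + ·) v w).map Val.num
  | .mul e₁ e₂ => (e₁.eval σ).bind fun v => (e₂.eval σ).bind fun w =>
      (Val.num₂ (· * ·) v w).map Val.num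
  | .prim f es => (tuple fun i => (es i).eval σ).bind f

/-- Evaluation of tests, undefined under the same conditions. -/
def Test.eval {S : Finset Var} (σ : Mem S) : Test → Option Bool
  | .tru => some true
  | .fls => some false
  | .and b₁ b₂ => (b₁.eval σ).bind fun s => (b₂.eval σ).map fun t => s && t
  | .or b₁ b₂ => (b₁.eval σ).bind fun s => (b₂.eval σ).map fun t => s || t
  | .not b => (b.eval σ).map fun s => !s
  | .eq e₁ e₂ => (e₁.eval σ).bind fun v => (e₂.eval σ).map fun w =>
      open Classical in decide (v = w)
  | .le e₁ e₂ => (e₁.eval σ).bind fun v => (e₂.eval σ).bind fun w =>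
      Val.num₂ (fun p q => decide (p ≤ q)) v w
  | .lt e₁ e₂ => (e₁.eval σ).bind fun v => (e₂.eval σ).bind fun w =>
      Val.num₂ (fun p q => decide (p < q)) v w
  | .rel r e₁ e₂ => (e₁.eval σ).bind fun v => (e₂.eval σ).bind fun w => r v w
end

/-- `Bern(p)`: the value `1` with probability `p` and `0` with probability `1 - p`. -/
def bernPMF (p : ℚ) (h : 0 ≤ p ∧ p ≤ 1) : PMF Val :=
  mix (ENNReal.ofReal p) (ENNReal.ofReal (1 - p))
    (by
      have h0 : (0 : ℝ) ≤ p := by exact_mod_cast h.1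
      have h1 : (0 : ℝ) ≤ 1 - p := sub_nonneg.2 (by exact_mod_cast h.2)
      rw [← ENNReal.ofReal_add h0 h1]; simp)
    (PMF.pure (.num 1)) (PMF.pure (.num 0))

/-- `Geo(p)`: the value `n` with probability `(1 - p)ⁿ p`. -/
def geoPMF (p : ℚ) (h : 0 < p ∧ p ≤ 1) : PMF Val :=
  PMF.map (fun n : ℕ => Val.num n)
    ⟨fun n => ENNReal.ofReal ((1 - (p : ℝ)) ^ n * p), by
      have h0 : (0 : ℝ) < p := by exact_mod_cast h.1
      have h1 : (0 : ℝ) ≤ 1 - p := sub_nonneg.2 (by exact_mod_cast h.2)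
      have hs : HasSum (fun n : ℕ => (1 - (p : ℝ)) ^ n * p) 1 := by
        have := (hasSum_geometric_of_lt_one h1 (by linarith)).mul_right (p : ℝ)
        rwa [sub_sub_cancel, inv_mul_cancel₀ h0.ne'] at this
      rw [Summable.hasSum_iff ENNReal.summable,
        ← ENNReal.ofReal_tsum_of_nonneg (fun n => by positivity) hs.summable, hs.tsum_eq,
        ENNReal.ofReal_one]⟩

/-- `d(v)`, undefined if `v` is not a legal parameter. The uniform distribution gives each entry
of a nonempty list of length `n` probability `1/n`. -/
def DistName.interp : DistName → Val → Option (PMF Val)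
  | .bern, .num p => if h : 0 ≤ p ∧ p ≤ 1 then some (bernPMF p h) else none
  | .geo, .num p => if h : 0 < p ∧ p ≤ 1 then some (geoPMF p h) else none
  | .unif, .list (v :: l) => some (PMF.ofMultiset ((v :: l : List Val) : Multiset Val) (by simp))
  | _, _ => none

/-- The update `σ[x := v]`. -/
def Mem.update {S : Finset Var} (σ : Mem S) (x : Var) (v : Val) : Mem S :=
  fun y => if y.1 = x then v else σ y

/-- The disjoint union `σ ⊎ τ` of memories (used for disjoint `S` and `T`). -/
def Mem.union {S T : Finset Var} (σ : Mem S) (τ : Mem T) : Mem (S ∪ T) :=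
  fun y => if h : y.1 ∈ S then σ ⟨y.1, h⟩
    else τ ⟨y.1, (Finset.mem_union.1 y.2).resolve_left h⟩

/-- The projection `π_T` of memories over `S ⊇ T`. -/
def Mem.proj {S T : Finset Var} (h : T ⊆ S) (σ : Mem S) : Mem T :=
  fun y => σ ⟨y.1, h y.2⟩

/-- `π_{S ∖ T}(σ) ⊎ τ`, for `T ⊆ S`: the memory `σ` with its `T`-part replaced by `τ`. -/
def Mem.replace {S T : Finset Var} (σ : Mem S) (τ : Mem T) : Mem S :=
  fun y => if h : y.1 ∈ T then τ ⟨y.1, h⟩ else σ y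

/-- The empty memory. -/
def Mem.emp : Mem ∅ := fun y => absurd y.2 (Finset.notMem_empty y.1)

/-- `I ∗ J = {σ ⊎ τ | σ ∈ I, τ ∈ J}`. -/
def sep {S T : Finset Var} (I : Finset (Mem S)) (J : Finset (Mem T)) : Finset (Mem (S ∪ T)) :=
  open Classical in Finset.image₂ Mem.union I J

/-! ### Semantics of actions -/

open ConvPow

/-- The basic semantics of actions. -/
def act {W : Finset Var} : Act → Mem W → ConvPow (Mem W)
  | .assign x e, σ =>
      if x ∈ W then
        match e.eval σ with
        | some v => eta (σ.update x v)
        | none => ⊥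
      else ⊥
  | .sample x d e, σ =>
      if x ∈ W then
        match (e.eval σ).bind d.interp with
        | some μ => single (μ.map fun v => σ.update x v)
        | none => ⊥
      else ⊥

section Invariant

variable {U W : Finset Var} (hU : U ⊆ W) (I : Finset (Mem U))

/-- `check`: faults unless the `U`-part of the memory is in the invariant. -/
def check (σ : Mem W) : ConvPow (Mem W) :=
  open Classical in if σ.proj hU ∈ I then eta σ else ⊥

/-- `replace`: the scheduler replaces the `U`-part of the memory by any element of the invariant.
(For the empty invariant, where there is nothing to choose from, execution faults.) -/
def replace (σ : Mem W) : ConvPow (Mem W) :=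
  if h : I.Nonempty then
    haveI : Nonempty I := h.to_subtype
    bigND fun τ : I => eta (σ.replace τ.1)
  else ⊥

/-- The invariant-sensitive semantics of actions. -/
def actInv (a : Act) (σ : Mem W) : ConvPow (Mem W) :=
  kleisli (check hU I) (kleisli (act a) (kleisli (replace I) (check hU I σ)))

end Invariant

/-! ### Pomsets with formulae -/

/-- The countable universe of nodes. -/
abbrev Node := ℕ

/-- Boolean formulae over nodes. -/
inductive Form : Type
  | tru : Form
  | fls : Form
  | var (x : Node) : Form
  | neg (ψ : Form) : Form
  | and (ψ₁ ψ₂ : Form) : Form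
  | or (ψ₁ ψ₂ : Form) : Form

namespace Form

/-- Truth of a formula under a valuation. -/
def holds (v : Node → Prop) : Form → Prop
  | tru => True
  | fls => False
  | var x => v x
  | neg ψ => ¬ ψ.holds v
  | and ψ₁ ψ₂ => ψ₁.holds v ∧ ψ₂.holds v
  | or ψ₁ ψ₂ => ψ₁.holds v ∨ ψ₂.holds v

/-- The variables of a formula. -/
def free : Form → Set Node
  | tru => ∅
  | fls => ∅
  | var x => {x}
  | neg ψ => ψ.free
  | and ψ₁ ψ₂ => ψ₁.free ∪ ψ₂.free
  | or ψ₁ ψ₂ => ψ₁.free ∪ ψ₂.free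

/-- Renaming of variables. -/
def rename (f : Node → Node) : Form → Form
  | tru => tru
  | fls => fls
  | var x => var (f x)
  | neg ψ => neg (ψ.rename f)
  | and ψ₁ ψ₂ => and (ψ₁.rename f) (ψ₂.rename f)
  | or ψ₁ ψ₂ => or (ψ₁.rename f) (ψ₂.rename f)

/-- Satisfiability. -/
def Sat (ψ : Form) : Prop := ∃ v, ψ.holds v

/-- Validity of the implication `ψ ⇒ φ`. -/
def Entails (ψ φ : Form) : Prop := ∀ v, ψ.holds v → φ.holds v

theorem rename_congr {f g : Node → Node} {ψ : Form} (h : ∀ x ∈ ψ.free, f x = g x) :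
    ψ.rename f = ψ.rename g := by
  induction ψ with
  | tru | fls => rfl
  | var x => simp [rename, h x rfl]
  | neg ψ ih => simp [rename, ih h]
  | and ψ₁ ψ₂ h1 h2 | or ψ₁ ψ₂ h1 h2 =>
    simp [rename, h1 fun x hx => h x (Or.inl hx), h2 fun x hx => h x (Or.inr hx)]

theorem rename_id (ψ : Form) : ψ.rename id = ψ := by
  induction ψ <;> simp_all [rename]

theorem rename_rename (f g : Node → Node) (ψ : Form) :
    (ψ.rename f).rename g = ψ.rename (g ∘ f) := by
  induction ψ <;> simp_all [rename]

theorem holds_rename (f : Node → Node) (v : Node → Prop) (ψ : Form) :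
    (ψ.rename f).holds v ↔ ψ.holds (v ∘ f) := by
  induction ψ <;> simp_all [rename, holds]

theorem entails_rename {f : Node → Node} {N : Set Node} (hf : Set.InjOn f N) {ψ φ : Form}
    (hψ : ψ.free ⊆ N) (hφ : φ.free ⊆ N) :
    (ψ.rename f).Entails (φ.rename f) ↔ ψ.Entails φ := by
  constructor
  · intro h v hv
    have key : ∀ χ : Form, χ.free ⊆ N → (χ.rename f).rename (Function.invFunOn f N) = χ := by
      intro χ hχ
      rw [rename_rename]
      refine (rename_congr fun x hx => ?_).trans (rename_id χ)
      exact hf.leftInvOn_invFunOn (hχ hx)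
    have := h (v ∘ Function.invFunOn f N)
    rwa [← holds_rename, ← holds_rename, key _ hψ, key _ hφ, imp_iff_right hv] at this
  · intro h v hv
    rw [holds_rename] at *
    exact h _ hv

end Form

/-- Labels of nodes: actions, tests, the no-op and the undetermined label. -/
inductive Lab : Type
  | act (a : Act) : Lab
  | test (b : Test) : Lab
  | noop : Lab
  | bot : Lab

/-- In the relation `lt` on `N`, there is a chain of `n` steps that ends in `x`. -/
def HasChain (N : Set Node) (lt : Node → Node → Prop) : ℕ → Node → Prop
  | 0, x => x ∈ N
  | n + 1, x => x ∈ N ∧ ∃ y, lt y x ∧ HasChain N lt n y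

/-- The node `x` is at distance `n` from the root: a longest chain that ends in `x` has `n`
steps. -/
def HasDist (N : Set Node) (lt : Node → Node → Prop) (n : ℕ) (x : Node) : Prop :=
  HasChain N lt n x ∧ ¬ HasChain N lt (n + 1) x

/-- Labelled partial orders with formulae: a strict partial order on a (countable) set `N` of nodes
with a single minimal element, in which every node is at a finite distance from the root and each
distance is taken by finitely many nodes, with labels such that `⊥`-nodes have no successors, and
with satisfiable formulae about preceding nodes that get stronger along the order. The order, labels
and formulae matter only on `N` (their values elsewhere are ignored by every definition below). -/
structure LPOF where
  N : Set Node
  lt : Node → Node → Prop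
  lab : Node → Lab
  form : Node → Form
  irrefl : ∀ x ∈ N, ¬ lt x x
  trans : ∀ x ∈ N, ∀ y ∈ N, ∀ z ∈ N, lt x y → lt y z → lt x z
  root : ∃! r, r ∈ N ∧ ∀ y ∈ N, ¬ lt y r
  dist : ∀ x ∈ N, ∃ n, HasDist N lt n x
  levels : ∀ n, {x | HasDist N lt n x}.Finite
  bot_max : ∀ x ∈ N, lab x = Lab.bot → ∀ y ∈ N, ¬ lt x y
  form_mono : ∀ x ∈ N, ∀ y ∈ N, lt x y → (form y).Entails (form x)
  form_sat : ∀ x ∈ N, (form x).Sat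
  form_free : ∀ x ∈ N, ∀ y ∈ (form x).free, y ∈ N ∧ lt y x

namespace LPOF

/-- The map `f` is an isomorphism from `α` to `β`. -/
structure IsIso (f : Node → Node) (α β : LPOF) : Prop where
  bij : Set.BijOn f α.N β.N
  lt_iff : ∀ x ∈ α.N, ∀ y ∈ α.N, α.lt x y ↔ β.lt (f x) (f y)
  lab : ∀ x ∈ α.N, α.lab x = β.lab (f x)
  form : ∀ x ∈ α.N, β.form (f x) = (α.form x).rename f

/-- Up to the renaming `f` of its nodes, `α` is obtained from `β` by cutting `β` off at nodes that
are labelled `⊥` in `α`; that is, `β` arises from `α` by replacing `⊥`-nodes by larger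
structures. -/
structure IsApprox (f : Node → Node) (α β : LPOF) : Prop where
  maps : Set.MapsTo f α.N β.N
  inj : Set.InjOn f α.N
  lt_iff : ∀ x ∈ α.N, ∀ y ∈ α.N, α.lt x y ↔ β.lt (f x) (f y)
  lab : ∀ x ∈ α.N, α.lab x = Lab.bot ∨ α.lab x = β.lab (f x)
  form : ∀ x ∈ α.N, β.form (f x) = (α.form x).rename f
  fresh : ∀ y ∈ β.N, y ∉ f '' α.N → ∃ x ∈ α.N, α.lab x = Lab.bot ∧ β.lt (f x) y

theorem IsIso.symm {f : Node → Node} {α β : LPOF} (h : IsIso f α β) :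
    IsIso (Function.invFunOn f α.N) β α := by
  have hinv : Set.InvOn (Function.invFunOn f α.N) f α.N β.N := h.bij.invOn_invFunOn
  have hb : Set.BijOn (Function.invFunOn f α.N) β.N α.N :=
    Set.BijOn.symm hinv.symm h.bij
  refine ⟨hb, fun x hx y hy => ?_, fun x hx => ?_, fun x hx => ?_⟩
  · rw [h.lt_iff _ (hb.mapsTo hx) _ (hb.mapsTo hy), hinv.2 hx, hinv.2 hy]
  · rw [h.lab _ (hb.mapsTo hx), hinv.2 hx]
  · have := h.form _ (hb.mapsTo hx)
    rw [hinv.2 hx] at this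
    rw [this, Form.rename_rename]
    symm
    refine (Form.rename_congr fun z hz => ?_).trans (Form.rename_id _)
    exact hinv.1 (α.form_free _ (hb.mapsTo hx) z hz).1

theorem IsIso.trans {f g : Node → Node} {α β γ : LPOF} (h : IsIso f α β) (h' : IsIso g β γ) :
    IsIso (g ∘ f) α γ where
  bij := h'.bij.comp h.bij
  lt_iff x hx y hy :=
    (h.lt_iff x hx y hy).trans (h'.lt_iff _ (h.bij.mapsTo hx) _ (h.bij.mapsTo hy))
  lab x hx := (h.lab x hx).trans (h'.lab _ (h.bij.mapsTo hx))
  form x hx := by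
    rw [← Form.rename_rename, ← h.form x hx]; exact h'.form _ (h.bij.mapsTo hx)

/-- Isomorphism of labelled partial orders with formulae. -/
instance setoid : Setoid LPOF where
  r α β := ∃ f, IsIso f α β
  iseqv :=
    { refl := fun _ => ⟨id, Set.bijOn_id _, fun _ _ _ _ => Iff.rfl, fun _ _ => rfl,
        fun _ _ => (Form.rename_id _).symm⟩
      symm := fun ⟨_, h⟩ => ⟨_, h.symm⟩
      trans := fun ⟨_, h⟩ ⟨_, h'⟩ => ⟨_, h.trans h'⟩ }

theorem IsIso.isApprox {f : Node → Node} {α β : LPOF} (h : IsIso f α β) : IsApprox f α β :=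
  ⟨h.bij.mapsTo, h.bij.injOn, h.lt_iff, fun x hx => Or.inr (h.lab x hx), h.form,
    fun _ hy hn => absurd (h.bij.surjOn hy) hn⟩

theorem IsApprox.trans {f g : Node → Node} {α β γ : LPOF} (h : IsApprox f α β)
    (h' : IsApprox g β γ) : IsApprox (g ∘ f) α γ where
  maps := h'.maps.comp h.maps
  inj := h'.inj.comp h.inj h.maps
  lt_iff x hx y hy := (h.lt_iff x hx y hy).trans (h'.lt_iff _ (h.maps hx) _ (h.maps hy))
  lab x hx := by
    rcases h.lab x hx with e | e
    · exact Or.inl e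
    · rw [e]; exact h'.lab _ (h.maps hx)
  form x hx := by
    rw [← Form.rename_rename, ← h.form x hx]; exact h'.form _ (h.maps hx)
  fresh z hz hn := by
    have old : ∀ b ∈ β.N, b ∉ f '' α.N → ∃ x ∈ α.N, α.lab x = Lab.bot ∧ γ.lt (g (f x)) (g b) := by
      intro b hb hbn
      obtain ⟨x, hx, hxb, hlt⟩ := h.fresh b hb hbn
      exact ⟨x, hx, hxb, (h'.lt_iff _ (h.maps hx) _ hb).1 hlt⟩
    by_cases hzg : z ∈ g '' β.N
    · obtain ⟨b, hb, rfl⟩ := hzg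
      refine old b hb ?_
      rintro ⟨x, hx, rfl⟩
      exact hn ⟨x, hx, rfl⟩
    · obtain ⟨b, hb, hbb, hlt⟩ := h'.fresh z hz hzg
      by_cases hbf : b ∈ f '' α.N
      · obtain ⟨x, hx, rfl⟩ := hbf
        refine ⟨x, hx, ?_, hlt⟩
        rcases h.lab x hx with e | e
        · exact e
        · rw [e, hbb]
      · obtain ⟨x, hx, hxb, hlt'⟩ := old b hb hbf
        exact ⟨x, hx, hxb, γ.trans _ (h'.maps (h.maps hx)) _ (h'.maps hb) _ hz hlt' hlt⟩

/-- An approximated structure contains all predecessors of its nodes. -/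
theorem IsApprox.down {f : Node → Node} {α β : LPOF} (h : IsApprox f α β) {x y : Node}
    (hx : x ∈ α.N) (hy : y ∈ β.N) (hlt : β.lt y (f x)) : y ∈ f '' α.N := by
  by_contra hn
  obtain ⟨z, hz, hzb, hl⟩ := h.fresh y hy hn
  exact α.bot_max z hz hzb x hx
    ((h.lt_iff z hz x hx).2 (β.trans _ (h.maps hz) _ hy _ (h.maps hx) hl hlt))

/-- The nodes that are ready to be scheduled, given the path condition `ψ` and the set `S` of nodes
that have already been processed. -/
def next (α : LPOF) (ψ : Form) (S : Set Node) : Set Node :=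
  {x | x ∈ α.N ∧ x ∉ S ∧ (∀ y ∈ α.N, α.lt y x → y ∈ S) ∧ ψ.Entails (α.form x)}

theorem next_subset (α : LPOF) (ψ : Form) (S : Set Node) : α.next ψ S ⊆ α.N := fun _ h => h.1

end LPOF

/-- Pomsets with formulae: isomorphism classes. -/
def Pom : Type := Quotient LPOF.setoid

namespace Pom

/-- The order on pomsets: `A ⊑ B` iff `B` is obtained by replacing `⊥`-nodes of `A`. -/
def le (A B : Pom) : Prop :=
  ∃ (α β : LPOF) (f : Node → Node),
    Quotient.mk LPOF.setoid α = A ∧ Quotient.mk LPOF.setoid β = B ∧ LPOF.IsApprox f α β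

/-- Finite pomsets. -/
def IsFin (A : Pom) : Prop := ∃ α : LPOF, Quotient.mk LPOF.setoid α = A ∧ α.N.Finite

/-- `A ≪ B`: the pomset `A` is a finite approximation of `B`. -/
def FinApprox (A B : Pom) : Prop := A.IsFin ∧ A.le B

end Pom

/-! ### Linearization -/

section Linearization

variable {U W : Finset Var} (hU : U ⊆ W) (I : Finset (Mem U))

/-- Linearization of a node `x` with label `l`: process `x`, then continue with `k`, which takes
the new path condition. An undefined test faults. -/
def linNode (l : Lab) (x : Node) (ψ : Form) (k : Form → Mem W → ConvPow (Mem W)) (σ : Mem W) :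
    ConvPow (Mem W) :=
  match l with
  | .act a => kleisli (k ψ) (actInv hU I a σ)
  | .test b =>
      match b.eval σ with
      | some true => k (ψ.and (.var x)) σ
      | some false => k (ψ.and (.neg (.var x))) σ
      | none => ⊥
  | .noop => k ψ σ
  | .bot => ⊥

/-- Linearization of a finite structure, given the path condition `ψ` and the set `S` of nodes that
have already been processed. -/
def linLPO (α : LPOF) (hα : α.N.Finite) (ψ : Form) (S : Set Node) :
    Mem W → ConvPow (Mem W) := fun σ =>
  open Classical in
  if h : (α.next ψ S).Nonempty then
    haveI : Finite (α.next ψ S) := (hα.subset (α.next_subset ψ S)).to_subtype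
    haveI : Nonempty (α.next ψ S) := h.to_subtype
    bigND fun x : α.next ψ S =>
      linNode hU I (α.lab x) x ψ (fun ψ' => linLPO α hα ψ' (insert x.1 S)) σ
  else eta σ
termination_by (α.N \ S).ncard
decreasing_by
  refine Set.ncard_lt_ncard ⟨fun y hy => ⟨hy.1, fun h => hy.2 (Or.inr h)⟩, fun h => ?_⟩
    (hα.subset Set.sdiff_subset)
  exact (h ⟨x.2.1, x.2.2.1⟩).2 (Or.inl rfl)


theorem linLPO_pos (α : LPOF) (hα : α.N.Finite) (ψ : Form) (S : Set Node) (σ : Mem W)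
    (h : (α.next ψ S).Nonempty) [Finite (α.next ψ S)] [Nonempty (α.next ψ S)] :
    linLPO hU I α hα ψ S σ = bigND fun x : α.next ψ S =>
      linNode hU I (α.lab x) x ψ (fun ψ' => linLPO hU I α hα ψ' (insert x.1 S)) σ := by
  rw [linLPO, dif_pos h]

theorem linLPO_neg (α : LPOF) (hα : α.N.Finite) (ψ : Form) (S : Set Node) (σ : Mem W)
    (h : ¬ (α.next ψ S).Nonempty) : linLPO hU I α hα ψ S σ = eta σ := by
  rw [linLPO, dif_neg h]

theorem next_approx {f : Node → Node} {α β : LPOF} (h : LPOF.IsApprox f α β) {ψ : Form}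
    {S : Set Node} (hS : S ⊆ α.N) (hψ : ψ.free ⊆ S) (hb : ∀ x ∈ S, α.lab x ≠ Lab.bot) :
    β.next (ψ.rename f) (f '' S) = f '' α.next ψ S := by
  have hent : ∀ x ∈ α.N,
      (ψ.rename f).Entails (β.form (f x)) ↔ ψ.Entails (α.form x) := fun x hx => by
    rw [h.form x hx]
    exact Form.entails_rename h.inj (hψ.trans hS) fun z hz => (α.form_free x hx z hz).1
  ext y
  constructor
  · rintro ⟨hy, hyS, hdown, he⟩
    by_cases hyf : y ∈ f '' α.N
    · obtain ⟨x, hx, rfl⟩ := hyf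
      refine ⟨x, ⟨hx, fun hxS => hyS ⟨x, hxS, rfl⟩, fun z hz hzx => ?_, (hent x hx).1 he⟩, rfl⟩
      obtain ⟨w, hw, hwz⟩ := hdown (f z) (h.maps hz) ((h.lt_iff z hz x hx).1 hzx)
      rwa [← h.inj (hS hw) hz hwz]
    · obtain ⟨x, hx, hxb, hlt⟩ := h.fresh y hy hyf
      obtain ⟨w, hw, hwx⟩ := hdown (f x) (h.maps hx) hlt
      rw [h.inj (hS hw) hx hwx] at hw
      exact absurd hxb (hb x hw)
  · rintro ⟨x, ⟨hx, hxS, hdown, he⟩, rfl⟩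
    refine ⟨h.maps hx, ?_, fun y hy hlt => ?_, (hent x hx).2 he⟩
    · rintro ⟨w, hw, hwx⟩
      rw [h.inj (hS hw) hx hwx] at hw
      exact hxS hw
    · obtain ⟨z, hz, rfl⟩ := h.down hx hy hlt
      exact ⟨z, hdown z hz ((h.lt_iff z hz x hx).2 hlt), rfl⟩

theorem linLPO_approx {f : Node → Node} {α β : LPOF} (h : LPOF.IsApprox f α β)
    (hα : α.N.Finite) (hβ : β.N.Finite) (n : ℕ) : ∀ (ψ : Form) (S : Set Node) (σ : Mem W),
    (α.N \ S).ncard = n → S ⊆ α.N → ψ.free ⊆ S → (∀ x ∈ S, α.lab x ≠ Lab.bot) →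
    linLPO hU I α hα ψ S σ ≤ linLPO hU I β hβ (ψ.rename f) (f '' S) σ := by
  induction n using Nat.strong_induction_on with
  | _ n ih =>
  intro ψ S σ hn hS hψ hb
  have hnext := next_approx h hS hψ hb
  by_cases hne : (α.next ψ S).Nonempty
  · have hne' : (β.next (ψ.rename f) (f '' S)).Nonempty := by rw [hnext]; exact hne.image f
    have : Finite (α.next ψ S) := (hα.subset (α.next_subset ψ S)).to_subtype
    have : Nonempty (α.next ψ S) := hne.to_subtype
    have : Finite (β.next (ψ.rename f) (f '' S)) :=
      (hβ.subset (β.next_subset _ _)).to_subtype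
    have : Nonempty (β.next (ψ.rename f) (f '' S)) := hne'.to_subtype
    rw [linLPO_pos hU I α hα ψ S σ hne, linLPO_pos hU I β hβ _ _ σ hne']
    have hbij : Set.BijOn f (α.next ψ S) (β.next (ψ.rename f) (f '' S)) := by
      rw [hnext]; exact (h.inj.mono (α.next_subset ψ S)).bijOn_image
    refine bigND_le (Set.BijOn.equiv f hbij) fun x => ?_
    obtain ⟨x, hx⟩ := x
    change linNode hU I (α.lab x) x ψ (fun ψ' => linLPO hU I α hα ψ' (insert x S)) σ ≤
      linNode hU I (β.lab (f x)) (f x) (ψ.rename f)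
        (fun ψ' => linLPO hU I β hβ ψ' (insert (f x) (f '' S))) σ
    rcases h.lab x hx.1 with e | e
    · rw [e]; exact bot_le
    by_cases hbot : α.lab x = Lab.bot
    · rw [hbot]; exact bot_le
    have hlt : (α.N \ insert x S).ncard < n := by
      rw [← hn]
      refine Set.ncard_lt_ncard ⟨fun y hy => ⟨hy.1, fun h => hy.2 (Or.inr h)⟩, fun h => ?_⟩
        (hα.subset Set.sdiff_subset)
      exact (h ⟨hx.1, hx.2.1⟩).2 (Or.inl rfl)
    have key : ∀ (ψ' : Form) (τ : Mem W), ψ'.free ⊆ insert x S →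
        linLPO hU I α hα ψ' (insert x S) τ ≤
          linLPO hU I β hβ (ψ'.rename f) (insert (f x) (f '' S)) τ := by
      intro ψ' τ hψ'
      rw [← Set.image_insert_eq]
      refine ih _ hlt ψ' _ τ rfl (Set.insert_subset hx.1 hS) hψ' ?_
      rintro y (rfl | hy)
      · exact hbot
      · exact hb y hy
    have hψx : ψ.free ⊆ insert x S := hψ.trans (Set.subset_insert _ _)
    rw [← e]
    cases hl : α.lab x with
    | act a => exact kleisli_mono (fun τ => key ψ τ hψx) le_rfl
    | test b =>
      simp only [linNode]
      cases hbe : b.eval σ with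
      | none => exact le_rfl
      | some t =>
        cases t with
        | true => exact key (ψ.and (.var x)) σ (Set.union_subset hψx (by simp [Form.free]))
        | false => exact key (ψ.and (.neg (.var x))) σ (Set.union_subset hψx (by simp [Form.free]))
    | noop => exact key ψ σ hψx
    | bot => exact absurd hl hbot
  · have hne' : ¬ (β.next (ψ.rename f) (f '' S)).Nonempty := by
      rw [hnext, Set.image_nonempty]; exact hne
    rw [linLPO_neg hU I α hα ψ S σ hne, linLPO_neg hU I β hβ _ _ σ hne']

theorem linLPO_approx_start {f : Node → Node} {α β : LPOF} (h : LPOF.IsApprox f α β)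
    (hα : α.N.Finite) (hβ : β.N.Finite) (σ : Mem W) :
    linLPO hU I α hα .tru ∅ σ ≤ linLPO hU I β hβ .tru ∅ σ := by
  have := linLPO_approx hU I h hα hβ _ .tru ∅ σ rfl (Set.empty_subset _)
    (by simp [Form.free]) (by simp)
  rwa [Set.image_empty] at this

open Classical in
/-- Linearization of a finite structure from the start (`⊥` for infinite structures). -/
def linRep (α : LPOF) (σ : Mem W) : ConvPow (Mem W) :=
  if hα : α.N.Finite then linLPO hU I α hα .tru ∅ σ else ⊥

theorem linRep_congr (α β : LPOF) (h : LPOF.setoid.r α β) : linRep hU I α = linRep hU I β := by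
  obtain ⟨f, hf⟩ := h
  have hfin : α.N.Finite ↔ β.N.Finite := hf.bij.finite_iff_finite
  funext σ
  unfold linRep
  by_cases hα : α.N.Finite
  · rw [dif_pos hα, dif_pos (hfin.1 hα)]
    exact le_antisymm (linLPO_approx_start hU I hf.isApprox hα (hfin.1 hα) σ)
      (linLPO_approx_start hU I hf.symm.isApprox (hfin.1 hα) hα σ)
  · rw [dif_neg hα, dif_neg fun h => hα (hfin.2 h)]

/-- Linearization of a finite pomset, through any of its representatives. -/
def linFin (A : Pom) : Mem W → ConvPow (Mem W) :=
  Quotient.lift (linRep hU I) (linRep_congr hU I) A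

end Linearization

namespace LPOF

theorem hasChain_mem {N : Set Node} {lt : Node → Node → Prop} {n : ℕ} {x : Node}
    (h : HasChain N lt n x) : x ∈ N := by
  cases n with
  | zero => exact h
  | succ n => exact h.1

theorem hasChain_anti {N : Set Node} {lt : Node → Node → Prop} {m n : ℕ} (hmn : m ≤ n) :
    ∀ {x : Node}, HasChain N lt n x → HasChain N lt m x := by
  induction hmn with
  | refl => exact id
  | @step n hm ih =>
    refine fun {x} h => ih ?_
    clear ih hm
    induction n generalizing x with
    | zero => exact h.1
    | succ n ih => exact ⟨h.1, h.2.imp fun y hy => ⟨hy.1, ih hy.2⟩⟩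

theorem exists_dist_below (β : LPOF) (n k : ℕ) :
    ∀ y, HasDist β.N β.lt (n + k + 1) y → ∃ x, β.lt x y ∧ HasDist β.N β.lt n x := by
  have step : ∀ (m : ℕ) (y : Node), HasDist β.N β.lt (m + 1) y →
      ∃ x, β.lt x y ∧ HasDist β.N β.lt m x := by
    rintro m y ⟨⟨hy, x, hxy, hx⟩, hn⟩
    exact ⟨x, hxy, hx, fun h => hn ⟨hy, x, hxy, h⟩⟩
  induction k with
  | zero => exact step n
  | succ k ih =>
    intro y hy
    obtain ⟨z, hzy, hz⟩ := step _ y hy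
    obtain ⟨x, hxz, hx⟩ := ih z hz
    exact ⟨x, β.trans x (hasChain_mem hx.1) z (hasChain_mem hz.1) y (hasChain_mem hy.1) hxz hzy, hx⟩

/-- The nodes of `β` at distance at most `n` from the root. -/
def upTo (β : LPOF) (n : ℕ) : Set Node := {x | x ∈ β.N ∧ ¬ HasChain β.N β.lt (n + 1) x}

theorem upTo_finite (β : LPOF) (n : ℕ) : (β.upTo n).Finite := by
  refine Set.Finite.subset (Set.Finite.biUnion (Set.finite_Iic n) fun k _ => β.levels k) ?_
  rintro x ⟨hx, hn⟩
  obtain ⟨k, hk⟩ := β.dist x hx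
  refine Set.mem_biUnion (x := k) ?_ hk
  by_contra hlt
  exact hn (hasChain_anti (Nat.lt_of_not_le hlt) hk.1)

theorem upTo_down (β : LPOF) (n : ℕ) {x y : Node} (hx : x ∈ β.upTo n) (hy : y ∈ β.N)
    (hlt : β.lt y x) : y ∈ β.upTo n :=
  ⟨hy, fun h => hx.2 (hasChain_anti (Nat.le_succ _) (⟨hx.1, y, hlt, h⟩ : HasChain _ _ (n + 2) x))⟩

theorem hasChain_mono {M N : Set Node} {lt : Node → Node → Prop} (h : M ⊆ N) :
    ∀ {n : ℕ} {x : Node}, HasChain M lt n x → HasChain N lt n x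
  | 0, _, hc => h hc
  | _ + 1, _, hc => ⟨h hc.1, hc.2.imp fun _ hy => ⟨hy.1, hasChain_mono h hy.2⟩⟩

theorem exists_hasDist {N : Set Node} {lt : Node → Node → Prop} {x : Node} (hx : x ∈ N) :
    ∀ n, ¬ HasChain N lt n x → ∃ k, HasDist N lt k x
  | 0, h => absurd hx h
  | n + 1, h => by
    by_cases hn : HasChain N lt n x
    · exact ⟨n, hn, h⟩
    · exact exists_hasDist hx n hn

open Classical in
/-- The part of `β` up to distance `n`, cut off at the nodes at distance `n` that have
successors. -/
def trunc (β : LPOF) (n : ℕ) : LPOF where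
  N := β.upTo n
  lt := β.lt
  lab x := if HasChain β.N β.lt n x ∧ ∃ y ∈ β.N, β.lt x y then Lab.bot else β.lab x
  form := β.form
  irrefl x hx := β.irrefl x hx.1
  trans x hx y hy z hz := β.trans x hx.1 y hy.1 z hz.1
  root := by
    obtain ⟨r, ⟨hr, hmin⟩, huniq⟩ := β.root
    refine ⟨r, ⟨⟨hr, ?_⟩, fun y hy => hmin y hy.1⟩, ?_⟩
    · rintro ⟨_, y, hy, hc⟩
      exact hmin y (hasChain_mem hc) hy
    · rintro s ⟨hs, hs'⟩
      exact huniq s ⟨hs.1, fun y hy hlt => hs' y (β.upTo_down n hs hy hlt) hlt⟩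
  dist x hx := exists_hasDist hx (n + 1) fun hc => hx.2 (hasChain_mono (fun _ hy => hy.1) hc)
  levels k := (β.upTo_finite n).subset fun x hx => hasChain_mem hx.1
  bot_max x hx hl y hy hlt := by
    by_cases hB : HasChain β.N β.lt n x ∧ ∃ y ∈ β.N, β.lt x y
    · exact hy.2 ⟨hy.1, x, hlt, hB.1⟩
    · rw [if_neg hB] at hl
      exact β.bot_max x hx.1 hl y hy.1 hlt
  form_mono x hx y hy := β.form_mono x hx.1 y hy.1
  form_sat x hx := β.form_sat x hx.1
  form_free x hx y hy :=
    have h := β.form_free x hx.1 y hy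
    ⟨β.upTo_down n hx h.1 h.2, h.2⟩

theorem trunc_isApprox (β : LPOF) (n : ℕ) : IsApprox id (β.trunc n) β where
  maps x hx := hx.1
  inj := Set.injOn_id _
  lt_iff _ _ _ _ := Iff.rfl
  lab x _ := by
    by_cases hB : HasChain β.N β.lt n x ∧ ∃ y ∈ β.N, β.lt x y
    · exact Or.inl (if_pos hB)
    · exact Or.inr (if_neg hB)
  form _ _ := (Form.rename_id _).symm
  fresh y hy hn := by
    have hc : HasChain β.N β.lt (n + 1) y := by
      by_contra hc
      exact hn ⟨y, ⟨hy, hc⟩, rfl⟩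
    obtain ⟨k, hk⟩ := β.dist y hy
    have hle : n + 1 ≤ k := by
      by_contra hlt
      exact hk.2 (hasChain_anti (by omega) hc)
    obtain ⟨j, rfl⟩ := Nat.exists_eq_add_of_le hle
    obtain ⟨x, hxy, hx⟩ := exists_dist_below β n j y (by rwa [show n + j + 1 = n + 1 + j by omega])
    exact ⟨x, ⟨hasChain_mem hx.1, hx.2⟩, if_pos ⟨hx.1, y, hy, hxy⟩, hxy⟩

theorem IsApprox.to_trunc {f : Node → Node} {α β : LPOF} (h : IsApprox f α β) {n : ℕ}
    (hn : ∀ x ∈ α.N, ¬ HasChain β.N β.lt n (f x)) : IsApprox f α (β.trunc n) where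
  maps x hx := ⟨h.maps hx, fun hc => hn x hx (hasChain_anti (Nat.le_succ n) hc)⟩
  inj := h.inj
  lt_iff := h.lt_iff
  lab x hx := by
    have : (β.trunc n).lab (f x) = β.lab (f x) := if_neg fun hc => hn x hx hc.1
    rw [this]
    exact h.lab x hx
  form := h.form
  fresh y hy := h.fresh y hy.1

theorem IsApprox.exists_bound {f : Node → Node} {α β : LPOF} (h : IsApprox f α β)
    (hα : α.N.Finite) : ∃ n, ∀ x ∈ α.N, ¬ HasChain β.N β.lt n (f x) := by
  have : ∀ x : α.N, ∃ n, ¬ HasChain β.N β.lt n (f x) := fun x =>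
    let ⟨n, hn⟩ := β.dist _ (h.maps x.2)
    ⟨n + 1, hn.2⟩
  choose d hd using this
  have := hα.to_subtype
  obtain ⟨n, hn⟩ := Set.Finite.bddAbove (Set.finite_range d)
  exact ⟨n, fun x hx hc => hd ⟨x, hx⟩ (hasChain_anti (hn ⟨_, rfl⟩) hc)⟩

/-- Two finite approximations of the same structure have a common upper bound among its finite
approximations. -/
theorem exists_join {f₁ f₂ : Node → Node} {α₁ α₂ β : LPOF} (h₁ : IsApprox f₁ α₁ β)
    (h₂ : IsApprox f₂ α₂ β) (hf₁ : α₁.N.Finite) (hf₂ : α₂.N.Finite) :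
    ∃ γ : LPOF, γ.N.Finite ∧ IsApprox f₁ α₁ γ ∧ IsApprox f₂ α₂ γ ∧ IsApprox id γ β := by
  obtain ⟨n₁, hn₁⟩ := h₁.exists_bound hf₁
  obtain ⟨n₂, hn₂⟩ := h₂.exists_bound hf₂
  exact ⟨β.trunc (max n₁ n₂), β.upTo_finite _,
    h₁.to_trunc fun x hx hc => hn₁ x hx (hasChain_anti (le_max_left _ _) hc),
    h₂.to_trunc fun x hx hc => hn₂ x hx (hasChain_anti (le_max_right _ _) hc),
    β.trunc_isApprox _⟩

end LPOF

section Lin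

variable {U W : Finset Var} (hU : U ⊆ W) (I : Finset (Mem U))

theorem Pom.IsFin.finite {α : LPOF} (h : Pom.IsFin (Quotient.mk LPOF.setoid α)) :
    α.N.Finite := by
  obtain ⟨β, he, hβ⟩ := h
  obtain ⟨f, hf⟩ := Quotient.exact he
  exact hf.bij.finite_iff_finite.1 hβ

theorem linFin_mk {α : LPOF} (hα : α.N.Finite) (σ : Mem W) :
    linFin hU I (Quotient.mk LPOF.setoid α) σ = linLPO hU I α hα .tru ∅ σ :=
  dif_pos hα

/-- The linearizations of the finite approximations of `A` at `σ`. -/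
def linApprox (A : Pom) (σ : Mem W) : Set (ConvPow (Mem W)) :=
  {S | ∃ B : Pom, B.FinApprox A ∧ S = linFin hU I B σ}

theorem linApprox_directed (A : Pom) (σ : Mem W) : DirectedOn (· ≤ ·) (linApprox hU I A σ) := by
  rintro _ ⟨_, ⟨hfin₁, α₁, β₁, f₁, rfl, hβ₁, h₁⟩, rfl⟩ _ ⟨_, ⟨hfin₂, α₂, β₂, f₂, rfl, rfl, h₂⟩, rfl⟩
  obtain ⟨g, hg⟩ := Quotient.exact hβ₁
  obtain ⟨γ, hγ, hj₁, hj₂, hj⟩ :=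
    LPOF.exists_join (h₁.trans hg.isApprox) h₂ hfin₁.finite hfin₂.finite
  refine ⟨_, ⟨Quotient.mk LPOF.setoid γ, ⟨⟨γ, rfl, hγ⟩, γ, β₂, id, rfl, rfl, hj⟩, rfl⟩, ?_, ?_⟩
  · rw [linFin_mk hU I hfin₁.finite, linFin_mk hU I hγ]
    exact linLPO_approx_start hU I hj₁ _ _ σ
  · rw [linFin_mk hU I hfin₂.finite, linFin_mk hU I hγ]
    exact linLPO_approx_start hU I hj₂ _ _ σ

/-- The invariant-sensitive linearization `lin^I(A) : Mem W → 𝒞(Mem W)` of a pomset `A`, the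
pointwise supremum of the linearizations of its finite approximations. -/
def lin (A : Pom) (σ : Mem W) : ConvPow (Mem W) :=
  dSup (linApprox hU I A σ) (linApprox_directed hU I A σ)

end Lin

end PCOL

end

noncomputable section

namespace PCOL

-- Order properties of the convex powerset operations

namespace ConvPow

variable {X Y : Type}

-- In the Smyth order, going down means allowing more outcomes. A larger invariant changes the
-- semantics in two ways: the checks become stricter, so execution faults (value `⊥`, all outcomes)
-- more often, and the scheduler may overwrite more of the memory, so there are more choices. Both
-- move the result down, and all constructions of the semantics are monotone.
--
-- What makes this work is isolated in the relation `Refines` between an invariant `J` on `U'` and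
-- an invariant `I` on `U ⊆ U'`: memories in `J` project into `I`, and `J` is stable under
-- overwriting the `U`-part by any member of `I`. Both `I ∗ J` over `I` and `I` over `{emp}` are
-- instances. The second is not literally a case of the first, since `{emp} ∗ I` consists of
-- memories over `∅ ∪ U` rather than `U`; an abstract relation treats both at once.
--
-- The heart is `Refines.actInv_le`, for a single action. Projection gives the comparison of the
-- checks (`check_le`). Stability lets the scheduler for `J` imitate each choice `τ ∈ I`: it picks
-- the current `U'`-part with its `U`-part overwritten by `τ`, which leaves the rest of the memory
-- alone (`replace_le`). This pick is in `J` only if the current `U'`-part is, so the comparison is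
-- made after the initial check has succeeded; if that check fails, the left side is already `⊥`.
-- The passage to pomsets is then formal: tests, ready nodes and finite approximations do not depend
-- on the invariant, so an induction on the unprocessed nodes (`linLPO_le`) and monotonicity of
-- suprema (`lin_le`) finish the proof.

/-- A fault cannot be repaired by later steps: `⊥` contains the point mass at divergence, and `fbot
f none` is everything, so any `ρ` arises by continuing that point mass with `ρ` itself. -/
theorem kleisli_bot (f : X → ConvPow Y) : kleisli f ⊥ = ⊥ :=
  le_bot_iff.1 <| le_iff.2 fun ρ _ =>
    ⟨PMF.pure none, mem_bot _, fun _ => ρ, fun x hx => by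
      rw [PMF.support_pure, Set.mem_singleton_iff] at hx
      rw [hx]; exact mem_bot _, (PMF.pure_bind none fun _ => ρ).symm⟩

/-- Only the value at `x` matters, because the sole element of `eta x` is supported there.
`kleisli_mono` would demand the inequality at all points, and for `replace` it is known only at
memories that pass the check. -/
theorem kleisli_eta_mono {f g : X → ConvPow Y} {x : X} (h : f x ≤ g x) :
    kleisli f (eta x) ≤ kleisli g (eta x) := by
  refine le_iff.2 ?_
  rintro ρ ⟨μ, hμ, ν, hν, rfl⟩
  refine ⟨μ, hμ, ν, fun o ho => ?_, rfl⟩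
  have hx : o = some x := by
    obtain rfl : μ = (PMF.pure x).map some := hμ
    simpa [PMF.pure_map] using ho
  subst hx
  exact le_iff.1 h (hν _ ho)

/-- Fewer choices of the scheduler give a smaller convex union. -/
theorem bigND_le_of_injective {ι κ : Type} [Finite ι] [Nonempty ι] [Finite κ] [Nonempty κ]
    {e : κ → ι} (he : Function.Injective e) {F : ι → ConvPow X} {G : κ → ConvPow X}
    (h : ∀ k, F (e k) ≤ G k) : bigND F ≤ bigND G := by
  refine le_iff.2 ?_
  rintro ρ ⟨μ, hμ, ν, hν, rfl⟩
  have hinv : ∀ k, Function.invFun e (e k) = k := Function.leftInverse_invFun he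
  -- The weights are pushed forward along `e`, and indices outside its range get weight zero. On the
  -- range, injectivity recovers the original index, hence the distribution chosen for it; elsewhere
  -- the value of `Function.invFun e` is irrelevant.
  refine ⟨μ.map (Option.map e), ?_, fun o => ν (o.map (Function.invFun e)), fun o ho => ?_, ?_⟩
  · change (μ.map (Option.map e)) none = 0
    rw [PMF.apply_eq_zero_iff, PMF.support_map]
    rintro ⟨o, ho, ho'⟩
    rw [Option.map_eq_none_iff] at ho'
    rw [ho'] at ho
    exact ho hμ
  · cases o with
    | none => exact mem_bot _
    | some i =>
      rw [PMF.support_map] at ho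
      obtain ⟨o, ho, ho'⟩ := ho
      obtain ⟨k, rfl, rfl⟩ := Option.map_eq_some_iff.1 ho'
      simp only [Option.map_some, hinv]
      exact le_iff.1 (h k) (hν _ ho)
  · rw [PMF.bind_map]
    congr 1
    funext o
    cases o <;> simp [hinv]

theorem dSup_le_dSup {D E : Set (ConvPow X)} (hD : DirectedOn (· ≤ ·) D)
    (hE : DirectedOn (· ≤ ·) E) (h : ∀ S ∈ D, ∃ T ∈ E, S ≤ T) : dSup D hD ≤ dSup E hE :=
  (isLUB_dSup D hD).2 fun S hS =>
    let ⟨_, hT, hST⟩ := h S hS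
    hST.trans ((isLUB_dSup E hE).1 hT)

end ConvPow

-- Refinement between invariants

open ConvPow

/-- The invariant `J` on the variables `U'` refines the invariant `I` on the variables `U ⊆ U'`:
the `U`-parts of the memories in `J` are in `I`, and may be replaced by any memory in `I`. -/
structure Refines {U U' : Finset Var} (h : U ⊆ U') (I : Finset (Mem U)) (J : Finset (Mem U')) :
    Prop where
  proj_mem : ∀ ρ ∈ J, ρ.proj h ∈ I
  replace_mem : ∀ ρ ∈ J, ∀ τ ∈ I, ρ.replace τ ∈ J

theorem mem_sep {U V : Finset Var} {I : Finset (Mem U)} {J : Finset (Mem V)}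
    {ρ : Mem (U ∪ V)} : ρ ∈ sep I J ↔ ∃ σ ∈ I, ∃ υ ∈ J, σ.union υ = ρ := by
  classical exact Finset.mem_image₂

/-- The components of a memory in `I ∗ J` are chosen independently: the `U`-part of `σ ⊎ υ` is `σ`,
and overwriting it by `τ` yields `τ ⊎ υ`. -/
theorem refines_sep {U V : Finset Var} (I : Finset (Mem U)) (J : Finset (Mem V)) :
    Refines Finset.subset_union_left I (sep I J) where
  proj_mem ρ hρ := by
    obtain ⟨σ, hσ, υ, -, rfl⟩ := mem_sep.1 hρ
    convert hσ
    funext y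
    simp [Mem.proj, Mem.union]
  replace_mem ρ hρ τ hτ := by
    obtain ⟨σ, -, υ, hυ, rfl⟩ := mem_sep.1 hρ
    refine mem_sep.2 ⟨τ, hτ, υ, hυ, ?_⟩
    funext y
    by_cases hy : y.1 ∈ U <;> simp [Mem.replace, Mem.union, hy]

/-- There is only one memory over `∅`, and overwriting an empty part changes nothing. -/
theorem refines_emp {U : Finset Var} (I : Finset (Mem U)) :
    Refines (Finset.empty_subset U) {Mem.emp} I where
  proj_mem _ _ := Finset.mem_singleton.2 (funext fun y => absurd y.2 (Finset.notMem_empty y.1))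
  replace_mem ρ hρ τ _ := by
    have : ρ.replace τ = ρ := funext fun y => dif_neg (Finset.notMem_empty y.1)
    rwa [this]

-- Monotonicity of the semantics along a refinement

namespace Refines

variable {U U' W : Finset Var} {h : U ⊆ U'} {I : Finset (Mem U)} {J : Finset (Mem U')}

theorem check_le (hr : Refines h I J) (hU' : U' ⊆ W) (σ : Mem W) :
    check hU' J σ ≤ check (h.trans hU') I σ := by
  unfold check
  by_cases hσ : σ.proj hU' ∈ J
  · have hσ' : σ.proj (h.trans hU') ∈ I := hr.proj_mem _ hσ
    rw [if_pos hσ, if_pos hσ']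
  · rw [if_neg hσ]; exact bot_le

/-- The hypothesis on `σ` is essential to the argument: a choice `τ ∈ I` is imitated by a choice in
`J` that keeps the values of `σ` on `U' ∖ U`, and these must be admissible for `J`. -/
theorem replace_le (hr : Refines h I J) (hU' : U' ⊆ W) {σ : Mem W} (hσ : σ.proj hU' ∈ J) :
    replace J σ ≤ replace I σ := by
  -- The parts of `σ` itself inhabit both invariants, so neither `replace` falls back to its default
  -- value `⊥`.
  have hJ : J.Nonempty := ⟨_, hσ⟩
  have hI : I.Nonempty := ⟨_, hr.proj_mem _ hσ⟩
  unfold replace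
  rw [dif_pos hJ, dif_pos hI]
  have := hJ.to_subtype
  have := hI.to_subtype
  refine bigND_le_of_injective
    (e := fun τ : I => ⟨(σ.proj hU').replace τ.1, hr.replace_mem _ hσ _ τ.2⟩) ?_ fun τ => ?_
  -- The map is injective because `τ` can be read off as the `U`-part of its image.
  · intro τ₁ τ₂ he
    refine Subtype.ext (funext fun y => ?_)
    have := congrFun (Subtype.ext_iff.1 he) ⟨y.1, h y.2⟩
    simpa [Mem.replace] using this
  -- Both replacements produce the same memory: `τ` on `U`, and the old values of `σ` on `U' ∖ U`
  -- and outside `U'`.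
  · refine le_of_eq (congrArg eta (funext fun y => ?_))
    by_cases hy : y.1 ∈ U
    · simp [Mem.replace, hy, h hy]
    · by_cases hy' : y.1 ∈ U' <;> simp [Mem.replace, Mem.proj, hy, hy']

theorem actInv_le (hr : Refines h I J) (hU' : U' ⊆ W) (a : Act) (σ : Mem W) :
    actInv hU' J a σ ≤ actInv (h.trans hU') I a σ := by
  refine kleisli_mono (hr.check_le hU') (kleisli_mono (fun _ => le_rfl) ?_)
  -- What remains is the initial check followed by `replace`. This pair cannot be compared factor by
  -- factor, since `replace_le` needs the check for `J` to have succeeded.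
  by_cases hσ : σ.proj hU' ∈ J
  · have hσ' : σ.proj (h.trans hU') ∈ I := hr.proj_mem _ hσ
    rw [check, check, if_pos hσ, if_pos hσ']
    exact kleisli_eta_mono (hr.replace_le hU' hσ)
  · rw [check, if_neg hσ, kleisli_bot]
    exact bot_le

/-- The invariant enters only at actions. A test is evaluated in the same memory on both sides, so
both take the same branch or both fault; `hk` ranges over all path conditions because tests extend
them. -/
theorem linNode_le (hr : Refines h I J) (hU' : U' ⊆ W) (l : Lab) (x : Node) (ψ : Form)
    {k k' : Form → Mem W → ConvPow (Mem W)} (hk : ∀ ψ' τ, k ψ' τ ≤ k' ψ' τ) (σ : Mem W) :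
    linNode hU' J l x ψ k σ ≤ linNode (h.trans hU') I l x ψ k' σ := by
  cases l with
  | act a => exact kleisli_mono (hk ψ) (hr.actInv_le hU' a σ)
  | test b =>
    simp only [linNode]
    split
    · exact hk _ _
    · exact hk _ _
    · exact le_rfl
  | noop => exact hk ψ σ
  | bot => exact le_rfl

/-- The set of ready nodes does not depend on the invariant, so both convex unions have the same
index set and are compared node by node. -/
theorem linLPO_le (hr : Refines h I J) (hU' : U' ⊆ W) (α : LPOF) (hα : α.N.Finite) (ψ : Form)
    (S : Set Node) (σ : Mem W) :
    linLPO hU' J α hα ψ S σ ≤ linLPO (h.trans hU') I α hα ψ S σ := by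
  induction hn : (α.N \ S).ncard using Nat.strong_induction_on generalizing ψ S σ with
  | _ n ih =>
  by_cases hne : (α.next ψ S).Nonempty
  · have : Finite (α.next ψ S) := (hα.subset (α.next_subset ψ S)).to_subtype
    have : Nonempty (α.next ψ S) := hne.to_subtype
    rw [linLPO_pos _ _ α hα ψ S σ hne, linLPO_pos _ _ α hα ψ S σ hne]
    refine bigND_le (Equiv.refl _) fun x => hr.linNode_le hU' _ _ _ (fun ψ' τ => ?_) σ
    refine ih _ ?_ ψ' _ τ rfl
    rw [← hn]
    -- The scheduled node `x` was unprocessed and now is not, so the measure drops strictly.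
    refine Set.ncard_lt_ncard ⟨fun y hy => ⟨hy.1, fun h => hy.2 (Or.inr h)⟩, fun h => ?_⟩
      (hα.subset Set.sdiff_subset)
    exact (h ⟨x.2.1, x.2.2.1⟩).2 (Or.inl rfl)
  · rw [linLPO_neg _ _ α hα ψ S σ hne, linLPO_neg _ _ α hα ψ S σ hne]

theorem linFin_le (hr : Refines h I J) (hU' : U' ⊆ W) (B : Pom) (σ : Mem W) :
    linFin hU' J B σ ≤ linFin (h.trans hU') I B σ := by
  induction B using Quotient.inductionOn with
  | h α =>
    -- One representative serves both sides; if it is infinite, both values are `⊥`.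
    change linRep hU' J α σ ≤ linRep (h.trans hU') I α σ
    unfold linRep
    split_ifs with hα
    · exact hr.linLPO_le hU' α hα _ _ σ
    · exact le_rfl

/-- Finite approximation is a relation between pomsets alone, so the same `B` indexes a member of
each directed family. -/
theorem lin_le (hr : Refines h I J) (hU' : U' ⊆ W) (A : Pom) (σ : Mem W) :
    lin hU' J A σ ≤ lin (h.trans hU') I A σ := by
  refine dSup_le_dSup _ _ ?_
  rintro _ ⟨B, hB, rfl⟩
  exact ⟨_, ⟨B, hB, rfl⟩, hr.linFin_le hU' B σ⟩

end Refines

end PCOL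

end

theorem mainTheorem7 (U V W : Finset PCOL.Var) (hUV : Disjoint U V) (hW : U ∪ V ⊆ W)
    (I : Finset (PCOL.Mem U)) (J : Finset (PCOL.Mem V)) (A : PCOL.Pom) :
    (∀ σ : PCOL.Mem W,
      PCOL.lin hW (PCOL.sep I J) A σ ≤ PCOL.lin (Finset.union_subset_left hW) I A σ) ∧
    (∀ σ : PCOL.Mem W,
      (PCOL.lin (Finset.union_subset_left hW) I A σ).carrier ⊆
        (PCOL.lin hW (PCOL.sep I J) A σ).carrier) ∧
    (∀ σ : PCOL.Mem W,
      (PCOL.lin (Finset.empty_subset W) {PCOL.Mem.emp} A σ).carrier ⊆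
        (PCOL.lin (Finset.union_subset_left hW) I A σ).carrier) :=
  ⟨fun σ => (PCOL.refines_sep I J).lin_le hW A σ,
    fun σ => PCOL.ConvPow.le_iff.1 ((PCOL.refines_sep I J).lin_le hW A σ),
    -- Here `I` plays the role of the finer invariant, and `{emp}` that of the coarser one.
    fun σ => PCOL.ConvPow.le_iff.1
      ((PCOL.refines_emp I).lin_le (Finset.union_subset_left hW) A σ)⟩
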